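/- **Setting.** Let $D,N\ge 0$ be integers, let $V=\mathbb C^N$, let $\mathcal Q$ be a set of subsets ("generalized colors") $\mathcal C\subseteq\{1,\dots,D\}$, and let $C$ be a positive semidefinite operator (the propagator) on $V^{\otimes D}$. A field configuration $\sigma=(\sigma_{\mathcal C})_{\mathcal C\in\mathcal Q}$ consists of a Hermitian operator $\sigma_{\mathcal C}$ on $V^{\otimes\mathcal C}$ for every $\mathcal C\in\mathcal Q$. For $\lambda\in\mathbb C$, with $\sqrt\lambda$ the principal root, the resolvent is $$R_\lambda(\sigma)=\Big[1-i\sqrt\lambda\;C^{1/2}\Big(\sum_{\mathcal C\in\mathcal Q}\sigma_{\mathcal C}\otimes 1\Big)C^{1/2}\Big]^{-1}.$$ (A matrix that is not invertible is given the inverse $0$; this does not occur for $\lambda\notin(-\infty,0)$.) A planar colored tree of order $n$ is a tree joining $n+1$ loop vertices by $n\ge1$ edges, with a cyclic order of the half-edges around each vertex and a generalized color in $\mathcal Q$ on each edge. It has $2n$ corners (arcs between consecutive half-edges around a vertex). A strand of color $c$ leaving a corner arrives at the next half-edge around the vertex. If $c$ belongs to the generalized color of that edge, the strand follows the edge and enters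 the corner after the opposite half-edge; otherwise it enters the next corner at the same vertex. If every corner $h$ bears an operator $X_h$ on $V^{\otimes D}$, the amplitude of the tree is $$\sum_{(i_h),(j_h)}\ \prod_h (X_h)_{i_h,j_h}\ \prod_{h}\prod_{c=1}^D \delta_{\,j_h^c,\ i_{s_c(h)}^c},$$ where $i_h,j_h\in\{1,\dots,N\}^D$ and $s_c(h)$ is the corner entered by the strand of color $c$ leaving $h$. Given a tree $T$, disjoint sets $A,A^\dagger$ of its corners and a field configuration $\sigma^h$ for each corner $h$ (all $\sigma^h$ may be equal), the dressed amplitude $A_T^{A,A^\dagger}$ is obtained with $X_h=C^{1/2}R_\lambda(\sigma^h)C^{1/2}$ for $h\in A$, $X_h=C^{1/2}R_\lambda(\sigma^h)^\dagger C^{1/2}$ for $h\in A^\dagger$, and $X_h=C$ at the other corners. The resolvent-free amplitude $A_T^\varnothing$ has $X_h=C$ at all corners. **Theorem (iterated Cauchy–Schwarz bound).** Let $\Omega\subseteq\mathbb C$ be a set of couplings (for instance a cardioid domain) and $K$ a real number such that $\|R_\lambda(\sigma)\|\le K$ in operator norm for all $\lambda\in\Omega$ and all field configurations $\sigma$. Then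 for all $n$, all planar colored trees $T$ of order $n$ with colors in $\mathcal Q$, all disjoint sets $A,A^\dagger$ of corners of $T$, all $\lambda\in\Omega$ and all choices of field configurations $(\sigma^h)$, $$\big|A_T^{A,A^\dagger}\big|\ \le\ K^{2n}\ \sup_{T'}\ \operatorname{Re} A_{T'}^\varnothing ,$$ where $T'$ runs over all planar colored trees of order $n$ with colors in $\mathcal Q$. (If $C$ is diagonal in the tensor-product basis, all $A_{T'}^\varnothing$ are non-negative real numbers and $\operatorname{Re}$ can be omitted. The bound is uniform in $N$ whenever $K$ is.) -/

import Mathlib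

open scoped Matrix.Norms.L2Operator MatrixOrder ComplexOrder

noncomputable section

namespace QuarticTensor

/-- The multi-index `(n_1, …, n_D)` of a rank-`D` tensor whose `D` indices (colors) all range over
`N` values. -/
abbrev Idx (D N : ℕ) : Type := Fin D → Fin N

/-- Operators on `V^{⊗ D}`, `V = ℂ^N`, as matrices in the tensor-product basis. With the open scope
`Matrix.Norms.L2Operator`, `‖·‖` on them is the Hilbert-space operator norm. -/
abbrev Op (D N : ℕ) : Type := Matrix (Idx D N) (Idx D N) ℂ

/-- A configuration of the intermediate fields of a quartic tensor model with interaction set `Q`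
(a set of generalized colors `𝒞 ⊆ {1, …, D}`): for each `𝒞 ∈ Q` a Hermitian matrix on `V^{⊗ 𝒞}`. -/
structure IntermediateField {D : ℕ} (Q : Finset (Finset (Fin D))) (N : ℕ) where
  mat : (c : {c // c ∈ Q}) → Matrix ({x // x ∈ c.1} → Fin N) ({x // x ∈ c.1} → Fin N) ℂ
  isHermitian : ∀ c, (mat c).IsHermitian

/-- `M ⊗ 1`: the operator acting as `M` on the indices with colors in `c` and as the identity on
those with colors outside `c`. -/
def ampliation {D N : ℕ} (c : Finset (Fin D))
    (M : Matrix ({x // x ∈ c} → Fin N) ({x // x ∈ c} → Fin N) ℂ) : Op D N :=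
  Matrix.of fun i j =>
    if ∀ x, x ∉ c → i x = j x then M (fun x => i x.1) (fun x => j x.1) else 0

/-- The total intermediate field `∑_{𝒞 ∈ Q} σ_𝒞 ⊗ 1`. -/
def IntermediateField.total {D N : ℕ} {Q : Finset (Finset (Fin D))}
    (σ : IntermediateField Q N) : Op D N :=
  ∑ c : {c // c ∈ Q}, ampliation c.1 (σ.mat c)

/-- The resolvent `R(σ) = [1 - i √lam C^{1/2} σ C^{1/2}]⁻¹` at coupling `lam`, with propagator `C`;
`√lam` is the principal square root, `CFC.sqrt` the operator square root. -/
def resolvent {D N : ℕ} {Q : Finset (Finset (Fin D))} (C : Op D N) (lam : ℂ)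
    (σ : IntermediateField Q N) : Op D N :=
  (1 - (Complex.I * lam ^ (1 / 2 : ℂ)) • (CFC.sqrt C * σ.total * CFC.sqrt C))⁻¹

/-- The vertices of a combinatorial map with rotation `rot`: the cycles of `rot`. -/
abbrev MapVertex {m : ℕ} (rot : Equiv.Perm (Fin m)) : Type :=
  Quotient (Equiv.Perm.SameCycle.setoid rot)

/-- The underlying graph of a combinatorial map: the vertices containing the half-edges `h` and
`flip h` are adjacent. -/
def mapGraph {m : ℕ} (rot flip : Equiv.Perm (Fin m)) : SimpleGraph (MapVertex rot) :=
  SimpleGraph.fromRel fun u v =>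
    ∃ h, u = Quotient.mk (Equiv.Perm.SameCycle.setoid rot) h ∧
      v = Quotient.mk (Equiv.Perm.SameCycle.setoid rot) (flip h)

/-- A planar colored tree of order `n`, with generalized colors in `Q`: a tree joining `n + 1`
loop vertices by `n` edges, with a cyclic order of the half-edges around each vertex and a
generalized color on each edge. It is given as a combinatorial map on `2 n` (labelled) half-edges:
`rot h` is the half-edge following `h` around its vertex, and `flip h` is the other half of the edge
containing `h`. -/
structure PlanarColoredTree {D : ℕ} (Q : Finset (Finset (Fin D))) (n : ℕ) where
  rot : Equiv.Perm (Fin (2 * n))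
  flip : Equiv.Perm (Fin (2 * n))
  flip_flip : ∀ h, flip (flip h) = h
  flip_ne : ∀ h, flip h ≠ h
  card_vertex : Nat.card (MapVertex rot) = n + 1
  isTree : (mapGraph rot flip).IsTree
  color : Fin (2 * n) → Finset (Fin D)
  color_flip : ∀ h, color (flip h) = color h
  color_mem : ∀ h, color h ∈ Q

/-- The `2 n` corners of the tree: corner `h` is the arc, around the vertex of `h`, between the
half-edge `h` and the next half-edge `rot h`. -/
abbrev PlanarColoredTree.Corner {D n : ℕ} {Q : Finset (Finset (Fin D))}
    (_T : PlanarColoredTree Q n) : Type := Fin (2 * n)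

/-- The corner entered by the strand of color `x` that leaves corner `h`. This strand arrives at the
half-edge `rot h`. If `x` belongs to the generalized color of that edge, it follows the edge and
enters the corner after the opposite half-edge; otherwise it stays at the same loop vertex and
enters the next corner. The cycles of this map are the faces of color `x`. -/
def PlanarColoredTree.strand {D n : ℕ} {Q : Finset (Finset (Fin D))}
    (T : PlanarColoredTree Q n) (x : Fin D) (h : T.Corner) : T.Corner :=
  if x ∈ T.color (T.rot h) then T.flip (T.rot h) else T.rot h

/-- The amplitude of a tree bearing the operator `X h` on each corner `h`: the corner `h` contributes
the coefficient `X h (i h) (j h)`, and Kronecker deltas identify, color by color, the outgoing index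
`j h` of a corner with the incoming index `i` of the corner next reached along the strand. -/
def PlanarColoredTree.contract {D N n : ℕ} {Q : Finset (Finset (Fin D))}
    (T : PlanarColoredTree Q n) (X : T.Corner → Op D N) : ℂ :=
  ∑ i : T.Corner → Idx D N, ∑ j : T.Corner → Idx D N,
    (∏ h, X h (i h) (j h)) * ∏ h, ∏ x, if j h x = i (T.strand x h) x then 1 else 0

/-- The amplitude `A_T^{A, A†}` of a resolvent-dressed tree: the corners in `A` bear
`C^{1/2} R C^{1/2}`, those in `A'` bear `C^{1/2} R† C^{1/2}` and all the others the propagator `C`.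
Each corner `h` is allowed its own field `σ h` in the resolvent `R = R(σ h)`; a single field, or
one field per loop vertex, is a special case. -/
def PlanarColoredTree.amplitude {D N n : ℕ} {Q : Finset (Finset (Fin D))}
    (T : PlanarColoredTree Q n) (C : Op D N) (lam : ℂ) (σ : T.Corner → IntermediateField Q N)
    (A A' : Finset T.Corner) : ℂ :=
  T.contract fun h =>
    if h ∈ A then CFC.sqrt C * resolvent C lam (σ h) * CFC.sqrt C
    else if h ∈ A' then CFC.sqrt C * (resolvent C lam (σ h)).conjTranspose * CFC.sqrt C
    else C

/-- The resolvent-free amplitude `A_T^∅`. -/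
def PlanarColoredTree.bareAmplitude {D N n : ℕ} {Q : Finset (Finset (Fin D))}
    (T : PlanarColoredTree Q n) (C : Op D N) : ℂ :=
  T.contract fun _ => C

end QuarticTensor

end

noncomputable section

namespace QuarticTensor

/-! Write `S = C^{1/2}`. After division by `K` at each of the `2n` corners, every corner bears `S U
S` with `‖U‖ ≤ 1`; corners without a resolvent fit too, since the zero field has resolvent `1` and
forces `K ≥ 1`.

Walking around a planar tree visits all its corners in one cycle, and the edges become a noncrossing
pairing of the `2n` sides met on the way. Cut this cycle at two opposite corners. For fixed indices
on the cut edges each half is an operator, and the amplitude is a sum of traces pairing the two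
halves through the cut corners. Cauchy–Schwarz for the Hilbert–Schmidt inner product, with the
contractions at the cut corners discarded, gives `|A|² ≤ r r'`; here `r` and `r'` are the
nonnegative amplitudes of the trees obtained by gluing each half to its mirror image, with `U = 1`
at the two cut corners (`norm_gluing_sq_le`, `norm_contract_sq_le`).

The iteration is replaced by an extremal argument. Let `F` be the finite set formed by `1`, the
given `U` and their adjoints. Finitely many trees bear operators of `F`, so some amplitude is
maximal. Then `r' ≤ |A|`, hence `|A| ≤ r`, and the mirrored tree is again maximal
(`IsMaximal.mirror`). Cutting just before a run of corners with `U = 1` lengthens the run by one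
(`exists_isMaximal_run`); once the run fills a half, one more reflection puts `1` everywhere and
leaves a resolvent-free amplitude. -/

/-- Every edge of the combinatorial map `(rot, flip)` separates it: some union of vertices contains
`a` but not `flip a`, and no other edge leaves it. -/
def EdgesSeparate {H : Type*} (rot flip : Equiv.Perm H) : Prop :=
  ∀ a, ∃ P : Set H, a ∈ P ∧ flip a ∉ P ∧ (∀ k, rot k ∈ P ↔ k ∈ P) ∧
    ∀ k ∈ P, k ≠ a → flip k ∈ P

/-! ### Trees as combinatorial maps all of whose edges separate -/

section Graph

variable {M : ℕ} {rot flip : Equiv.Perm (Fin M)}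

/-- The vertex of a half-edge. -/
def vertexOf (rot : Equiv.Perm (Fin M)) (h : Fin M) : MapVertex rot :=
  Quotient.mk (Equiv.Perm.SameCycle.setoid rot) h

lemma vertexOf_eq_iff {a b : Fin M} : vertexOf rot a = vertexOf rot b ↔ rot.SameCycle a b :=
  Quotient.eq (r := Equiv.Perm.SameCycle.setoid rot)

lemma vertexOf_rot (h : Fin M) : vertexOf rot (rot h) = vertexOf rot h :=
  vertexOf_eq_iff.2 (Equiv.Perm.sameCycle_apply_left.2 (Equiv.Perm.SameCycle.refl _ _))

lemma vertexOf_surjective : Function.Surjective (vertexOf rot) := Quotient.mk_surjective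

lemma mapGraph_adj_iff (hff : ∀ h, flip (flip h) = h) {u v : MapVertex rot} :
    (mapGraph rot flip).Adj u v ↔
      u ≠ v ∧ ∃ h, u = vertexOf rot h ∧ v = vertexOf rot (flip h) := by
  rw [mapGraph, SimpleGraph.fromRel_adj]
  refine and_congr_right fun _ => ⟨?_, fun h => Or.inl h⟩
  rintro (h | ⟨h, h1, h2⟩)
  · exact h
  · exact ⟨flip h, h2, by rw [hff]; exact h1⟩

lemma mem_iff_of_vertexOf_eq {P : Set (Fin M)} (hP : ∀ k, rot k ∈ P ↔ k ∈ P) {a b : Fin M}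
    (h : vertexOf rot a = vertexOf rot b) : a ∈ P ↔ b ∈ P := by
  obtain ⟨i, -, rfl⟩ := (vertexOf_eq_iff.1 h).exists_pow_eq'
  clear h
  induction i with
  | zero => rfl
  | succ i ih => rw [pow_succ', Equiv.Perm.mul_apply, hP, ih]

/-- The two ends of the edge of a half-edge. -/
def edgeOf (rot flip : Equiv.Perm (Fin M)) (h : Fin M) : Sym2 (MapVertex rot) :=
  s(vertexOf rot h, vertexOf rot (flip h))

lemma edgeOf_flip (hff : ∀ h, flip (flip h) = h) (h : Fin M) :
    edgeOf rot flip (flip h) = edgeOf rot flip h := by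
  rw [edgeOf, hff, Sym2.eq_swap, edgeOf]

lemma exists_edgeOf_eq (hff : ∀ h, flip (flip h) = h) {e : Sym2 (MapVertex rot)}
    (he : e ∈ (mapGraph rot flip).edgeSet) : ∃ h, edgeOf rot flip h = e := by
  induction e with
  | h u v =>
    obtain ⟨-, h, rfl, rfl⟩ := (mapGraph_adj_iff hff).1 he
    exact ⟨h, rfl⟩

open Classical in
lemma two_mul_card_image_edgeOf_le (hff : ∀ h, flip (flip h) = h) (hne : ∀ h, flip h ≠ h)
    (S : Finset (Fin M)) (hS : ∀ h ∈ S, flip h ∈ S) :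
    2 * (S.image (edgeOf rot flip)).card ≤ S.card := by
  refine Finset.mul_card_image_le_card _ _ fun e he => ?_
  obtain ⟨h, hh, rfl⟩ := Finset.mem_image.1 he
  rw [← Finset.card_pair (hne h)]
  refine Finset.card_le_card ?_
  intro k hk
  rcases Finset.mem_insert.1 hk with rfl | hk
  · simp [hS h hh, edgeOf_flip hff]
  · rw [Finset.mem_singleton.1 hk]; simp [hh]

-- A counting argument: the graph has `n` edges and there are `n` pairs of half-edges, so no pair
-- can be a loop or duplicate the edge of another pair.
open Classical in
lemma edgeOf_mem_edgeSet_and_unique {n : ℕ} {rot flip : Equiv.Perm (Fin (2 * n))}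
    (hff : ∀ h, flip (flip h) = h) (hne : ∀ h, flip h ≠ h)
    (hcard : Nat.card (MapVertex rot) = n + 1) (ht : (mapGraph rot flip).IsTree)
    (a : Fin (2 * n)) :
    edgeOf rot flip a ∈ (mapGraph rot flip).edgeSet ∧
      ∀ h, edgeOf rot flip h = edgeOf rot flip a → h = a ∨ h = flip a := by
  have hE : (mapGraph rot flip).edgeFinset.card + 1 = n + 1 := by
    rw [ht.card_edgeFinset, ← hcard, Nat.card_eq_fintype_card]
  set S : Finset (Fin (2 * n)) := Finset.univ \ {a, flip a} with hSdef
  have hS : ∀ h ∈ S, flip h ∈ S := by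
    intro h hh
    simp only [hSdef, Finset.mem_sdiff, Finset.mem_univ, true_and, Finset.mem_insert,
      Finset.mem_singleton, not_or] at hh ⊢
    exact ⟨fun h' => hh.2 (by rw [← h', hff]), fun h' => hh.1 (flip.injective h')⟩
  have hScard : S.card = 2 * n - 2 := by
    rw [hSdef, Finset.card_sdiff_of_subset (Finset.subset_univ _), Finset.card_pair (hne a).symm,
      Finset.card_univ, Fintype.card_fin]
  have hn : 0 < 2 * n := a.pos
  -- Without the pair of `a` at most `n - 1` edges are covered; the edge missed can only come from
  -- that pair.
  have key : ¬ (mapGraph rot flip).edgeFinset ⊆ S.image (edgeOf rot flip) := by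
    intro hsub
    have h1 := Finset.card_le_card hsub
    have h2 := two_mul_card_image_edgeOf_le (rot := rot) hff hne S hS
    omega
  rw [Finset.not_subset] at key
  obtain ⟨e, he, heS⟩ := key
  rw [SimpleGraph.mem_edgeFinset] at he
  obtain ⟨k, rfl⟩ := exists_edgeOf_eq hff he
  have hS' : ∀ h, edgeOf rot flip h = edgeOf rot flip k → h = a ∨ h = flip a := by
    intro h hh
    by_contra hcon
    exact heS (Finset.mem_image.2 ⟨h, by simpa [hSdef] using hcon, hh⟩)
  have hka : edgeOf rot flip k = edgeOf rot flip a := by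
    rcases hS' k rfl with h | h
    · rw [h]
    · rw [h, edgeOf_flip hff]
  rw [← hka]
  exact ⟨he, hS'⟩

/-- In a planar tree, every edge separates. -/
lemma edgesSeparate_of_isTree {n : ℕ} {rot flip : Equiv.Perm (Fin (2 * n))}
    (hff : ∀ h, flip (flip h) = h) (hne : ∀ h, flip h ≠ h)
    (hcard : Nat.card (MapVertex rot) = n + 1) (ht : (mapGraph rot flip).IsTree) :
    EdgesSeparate rot flip := by
  intro a
  obtain ⟨hmem, huniq⟩ := edgeOf_mem_edgeSet_and_unique hff hne hcard ht a
  have hbr := SimpleGraph.isAcyclic_iff_forall_isBridge.1 ht.isAcyclic hmem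
  rw [edgeOf, SimpleGraph.isBridge_iff] at hbr
  set G' := (mapGraph rot flip).deleteEdges {s(vertexOf rot a, vertexOf rot (flip a))} with hG'
  refine ⟨{h | G'.Reachable (vertexOf rot a) (vertexOf rot h)}, SimpleGraph.Reachable.refl _, hbr,
    fun k => by simp only [Set.mem_ofPred_eq, vertexOf_rot], fun k hk hka => ?_⟩
  have hkf : k ≠ flip a := by rintro rfl; exact hbr hk
  refine SimpleGraph.Reachable.trans hk ?_
  by_cases hv : vertexOf rot k = vertexOf rot (flip k)
  · rw [← hv]
  · refine SimpleGraph.Adj.reachable ?_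
    rw [hG', SimpleGraph.deleteEdges_adj]
    refine ⟨(mapGraph_adj_iff hff).2 ⟨hv, k, rfl, rfl⟩, fun h => ?_⟩
    rcases huniq k h with h | h
    · exact hka h
    · exact hkf h

/-- A contour step `flip * rot` turns around a vertex and then crosses one edge, so it never leaves
a connected component. -/
lemma connected_of_sameCycle [NeZero M] (hff : ∀ h, flip (flip h) = h)
    (hc : ∀ a b, (flip * rot).SameCycle a b) : (mapGraph rot flip).Connected := by
  have step : ∀ h, (mapGraph rot flip).Reachable (vertexOf rot h)
      (vertexOf rot ((flip * rot) h)) := by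
    intro h
    rw [← vertexOf_rot h, Equiv.Perm.mul_apply]
    by_cases hv : vertexOf rot (rot h) = vertexOf rot (flip (rot h))
    · rw [← hv]
    · exact SimpleGraph.Adj.reachable ((mapGraph_adj_iff hff).2 ⟨hv, _, rfl, rfl⟩)
  have : Nonempty (MapVertex rot) := ⟨vertexOf rot 0⟩
  refine SimpleGraph.Connected.mk fun u v => ?_
  obtain ⟨a, rfl⟩ := vertexOf_surjective u
  obtain ⟨b, rfl⟩ := vertexOf_surjective v
  obtain ⟨i, -, rfl⟩ := (hc a b).exists_pow_eq'
  induction i with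
  | zero => rfl
  | succ i ih => rw [pow_succ', Equiv.Perm.mul_apply]; exact ih.trans (step _)

lemma EdgesSeparate.edgeOf_eq (hs : EdgesSeparate rot flip) (hff : ∀ h, flip (flip h) = h)
    {a h : Fin M} (he : edgeOf rot flip h = edgeOf rot flip a) : h = a ∨ h = flip a := by
  obtain ⟨P, h1, h2, h3, h4⟩ := hs a
  by_contra hcon
  rw [not_or] at hcon
  rw [edgeOf, edgeOf, Sym2.eq_iff] at he
  rcases he with ⟨e1, e2⟩ | ⟨e1, e2⟩
  · exact h2 ((mem_iff_of_vertexOf_eq h3 e2).1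
      (h4 _ ((mem_iff_of_vertexOf_eq h3 e1).2 h1) hcon.1))
  · have h5 := h4 _ ((mem_iff_of_vertexOf_eq h3 e2).2 h1)
      (fun h' => hcon.2 (by rw [← h', hff]))
    rw [hff] at h5
    exact h2 ((mem_iff_of_vertexOf_eq h3 e1).1 h5)

lemma EdgesSeparate.adj (hs : EdgesSeparate rot flip) (hff : ∀ h, flip (flip h) = h) (a : Fin M) :
    (mapGraph rot flip).Adj (vertexOf rot a) (vertexOf rot (flip a)) := by
  obtain ⟨P, h1, h2, h3, h4⟩ := hs a
  exact (mapGraph_adj_iff hff).2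
    ⟨fun h => h2 ((mem_iff_of_vertexOf_eq h3 h).1 h1), a, rfl, rfl⟩

/-- Every edge is a bridge: a walk that avoids the edge of `a` cannot leave the set `P` separating
`a` from `flip a`. -/
lemma EdgesSeparate.isAcyclic (hs : EdgesSeparate rot flip) (hff : ∀ h, flip (flip h) = h) :
    (mapGraph rot flip).IsAcyclic := by
  rw [SimpleGraph.isAcyclic_iff_forall_isBridge]
  intro e he
  obtain ⟨a, rfl⟩ := exists_edgeOf_eq hff he
  rw [edgeOf, SimpleGraph.isBridge_iff]
  intro hr
  obtain ⟨P, h1, h2, h3, h4⟩ := hs a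
  obtain ⟨w⟩ := hr
  have : ∀ (u v : MapVertex rot) (_ : ((mapGraph rot flip).deleteEdges
      {s(vertexOf rot a, vertexOf rot (flip a))}).Walk u v) (x y : Fin M),
      u = vertexOf rot x → v = vertexOf rot y → x ∈ P → y ∈ P := by
    intro u v w
    induction w with
    | nil => exact fun x y hx hy hxP => (mem_iff_of_vertexOf_eq h3 (hx.symm.trans hy)).1 hxP
    | cons hadj w ih =>
      intro x y hx hy hxP
      rw [SimpleGraph.deleteEdges_adj] at hadj
      obtain ⟨hadj, hnot⟩ := hadj
      obtain ⟨-, k, hk1, hk2⟩ := (mapGraph_adj_iff hff).1 hadj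
      refine ih (flip k) y hk2 hy (h4 k ?_ ?_)
      · exact (mem_iff_of_vertexOf_eq h3 (hx.symm.trans hk1)).1 hxP
      · rintro rfl
        exact hnot (by rw [hk1, hk2]; rfl)
  exact h2 (this _ _ w a (flip a) rfl rfl h1)

open Classical in
lemma EdgesSeparate.card_edgeFinset {n : ℕ} {rot flip : Equiv.Perm (Fin (2 * n))}
    (hs : EdgesSeparate rot flip) (hff : ∀ h, flip (flip h) = h) (hne : ∀ h, flip h ≠ h) :
    (mapGraph rot flip).edgeFinset.card = n := by
  have h1 : (Finset.univ : Finset (Fin (2 * n))).card =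
      ∑ b ∈ (mapGraph rot flip).edgeFinset,
        (Finset.univ.filter fun a => edgeOf rot flip a = b).card :=
    Finset.card_eq_sum_card_fiberwise fun a _ => by
      rw [Finset.mem_coe, SimpleGraph.mem_edgeFinset]
      exact hs.adj hff a
  rw [Finset.sum_congr rfl (g := fun _ => 2), Finset.sum_const, Finset.card_univ,
    Fintype.card_fin, smul_eq_mul] at h1
  · omega
  · intro e he
    rw [SimpleGraph.mem_edgeFinset] at he
    obtain ⟨a, rfl⟩ := exists_edgeOf_eq hff he
    refine Eq.trans ?_ (Finset.card_pair (hne a).symm)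
    congr 1
    ext k
    simp only [Finset.mem_filter, Finset.mem_univ, true_and, Finset.mem_insert,
      Finset.mem_singleton]
    refine ⟨hs.edgeOf_eq hff, ?_⟩
    rintro (rfl | rfl)
    · rfl
    · exact edgeOf_flip hff a

lemma EdgesSeparate.isTree [NeZero M] (hs : EdgesSeparate rot flip)
    (hff : ∀ h, flip (flip h) = h) (hc : ∀ a b, (flip * rot).SameCycle a b) :
    (mapGraph rot flip).IsTree :=
  ⟨connected_of_sameCycle hff hc, hs.isAcyclic hff⟩

lemma EdgesSeparate.card_vertex {n : ℕ} [NeZero n] {rot flip : Equiv.Perm (Fin (2 * n))}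
    (hs : EdgesSeparate rot flip) (hff : ∀ h, flip (flip h) = h) (hne : ∀ h, flip h ≠ h)
    (hc : ∀ a b, (flip * rot).SameCycle a b) : Nat.card (MapVertex rot) = n + 1 := by
  classical
  rw [Nat.card_eq_fintype_card, ← (hs.isTree hff hc).card_edgeFinset, hs.card_edgeFinset hff hne]

/-- The contour of a planar tree passes through all corners. -/
lemma EdgesSeparate.sameCycle (hs : EdgesSeparate rot flip) (hff : ∀ h, flip (flip h) = h)
    (hconn : (mapGraph rot flip).Connected) (a b : Fin M) : (flip * rot).SameCycle a b := by
  set c := flip * rot with hc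
  have hrot : ∀ k, rot k = flip (c k) := fun k => by rw [hc, Equiv.Perm.mul_apply, hff]
  have key : ∀ a, c.SameCycle a (flip a) := by
    intro a
    obtain ⟨P, h1, h2, h3, h4⟩ := hs a
    -- The contour of a finite map returns to `a` through `c⁻¹ a`, so starting from `a` it has to
    -- leave `P` at some time.
    have hpre : c⁻¹ a ∉ P := by
      rw [← h3, hrot, show c (c⁻¹ a) = a by simp]
      exact h2
    obtain ⟨i, -, hi⟩ := (show c.SameCycle a (c⁻¹ a) from
      ⟨-1, by rw [zpow_neg_one]⟩).exists_pow_eq'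
    have hex : ∃ j, (c ^ j) a ∉ P := ⟨i, hi ▸ hpre⟩
    classical
    obtain ⟨j, hj⟩ : ∃ j, Nat.find hex = j + 1 := by
      refine Nat.exists_eq_succ_of_ne_zero fun h0 => ?_
      have := Nat.find_spec hex
      rw [h0] at this
      exact this h1
    have hin : (c ^ j) a ∈ P := not_not.1 (Nat.find_min hex (by omega))
    have hout : (c ^ (j + 1)) a ∉ P := hj ▸ Nat.find_spec hex
    rw [pow_succ', Equiv.Perm.mul_apply] at hout
    -- The only exit from `P` is the edge of `a`, so the first step outside `P` lands on `flip a`.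
    have hra : rot ((c ^ j) a) = a := by
      by_contra hcon
      exact hout (by rw [hc]; exact h4 _ ((h3 _).2 hin) hcon)
    refine ⟨(j + 1 : ℕ), ?_⟩
    rw [zpow_natCast, pow_succ', Equiv.Perm.mul_apply]
    conv_lhs => rw [hc]
    rw [Equiv.Perm.mul_apply, hra]
  have hrotc : ∀ k, c.SameCycle k (rot k) := fun k => by
    rw [hrot]
    exact (Equiv.Perm.sameCycle_apply_right.2 (Equiv.Perm.SameCycle.refl c k)).trans (key _)
  have hvert : ∀ x y, vertexOf rot x = vertexOf rot y → c.SameCycle x y := fun x y h =>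
    (mem_iff_of_vertexOf_eq (P := {z | c.SameCycle x z})
      (fun k => ⟨fun h => h.trans (hrotc k).symm, fun h => h.trans (hrotc k)⟩) h).1
      (Equiv.Perm.SameCycle.refl _ _)
  obtain ⟨w⟩ := hconn.preconnected (vertexOf rot a) (vertexOf rot b)
  have : ∀ (u v : MapVertex rot) (_ : (mapGraph rot flip).Walk u v) (x y : Fin M),
      u = vertexOf rot x → v = vertexOf rot y → c.SameCycle x y := by
    intro u v w
    induction w with
    | nil => exact fun x y hx hy => hvert x y (hx.symm.trans hy)
    | cons hadj w ih =>
      intro x y hx hy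
      obtain ⟨-, k, hk1, hk2⟩ := (mapGraph_adj_iff hff).1 hadj
      exact (hvert x k (hx.symm.trans hk1)).trans ((key k).trans (ih (flip k) y hk2 hy))
  exact this _ _ w a b rfl rfl

end Graph

/-! ### Noncrossing pairings of the sides of a contour -/

/-- The sides of the edges of a planar tree with `m + 1` edges, met along the contour: first
`inl 0, …, inl m`, then `inr m, …, inr 0`. -/
abbrev Side (m : ℕ) : Type := Fin (m + 1) ⊕ Fin (m + 1)

/-- The position along the contour. -/
def sidePos (m : ℕ) : Side m ≃ Fin (2 * (m + 1)) :=
  (Equiv.sumCongr (Equiv.refl _) Fin.revPerm).trans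
    (finSumFinEquiv.trans (finCongr (two_mul (m + 1)).symm))

@[simp]
lemma sidePos_inl {m : ℕ} (k : Fin (m + 1)) : (sidePos m (Sum.inl k) : ℕ) = k := by
  simp [sidePos]

@[simp]
lemma sidePos_inr {m : ℕ} (k : Fin (m + 1)) : (sidePos m (Sum.inr k) : ℕ) = 2 * m + 1 - k := by
  simp [sidePos, Fin.val_rev]
  omega

lemma sidePos_swap {m : ℕ} (z : Side m) : (sidePos m z.swap : ℕ) = 2 * m + 1 - sidePos m z := by
  rcases z with k | k
  · simp
  · simp; omega

lemma sidePos_ext {m : ℕ} {a b : Side m} (h : (sidePos m a : ℕ) = sidePos m b) : a = b :=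
  (sidePos m).injective (Fin.ext h)

/-- The cyclic order of the sides along the contour. -/
def contour (m : ℕ) : Equiv.Perm (Side m) := (sidePos m).symm.permCongr (finRotate (2 * m + 2))

lemma sidePos_contour {m : ℕ} (z : Side m) :
    (sidePos m (contour m z) : ℕ) = if (sidePos m z : ℕ) = 2 * m + 1 then 0
      else (sidePos m z : ℕ) + 1 := by
  have h : sidePos m (contour m z) = finRotate (2 * m + 1 + 1) (sidePos m z) := by
    simp [contour, Equiv.permCongr_apply]
  rw [h, finRotate_apply]
  refine (Fin.val_add_one (n := 2 * m + 1) (sidePos m z)).trans ?_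
  simp only [Fin.ext_iff, Fin.val_last]

lemma contour_inl_castSucc {m : ℕ} (k : Fin m) :
    contour m (Sum.inl k.castSucc) = Sum.inl k.succ := by
  apply sidePos_ext
  rw [sidePos_contour]
  simp
  omega

lemma contour_inl_last (m : ℕ) :
    contour m (Sum.inl (Fin.last m)) = Sum.inr (Fin.last m) := by
  apply sidePos_ext
  rw [sidePos_contour]
  simp
  split_ifs <;> omega

lemma contour_inr_succ {m : ℕ} (k : Fin m) :
    contour m (Sum.inr k.succ) = Sum.inr k.castSucc := by
  apply sidePos_ext
  rw [sidePos_contour]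
  simp
  split_ifs <;> omega

lemma contour_inr_zero (m : ℕ) : contour m (Sum.inr 0) = Sum.inl 0 := by
  apply sidePos_ext
  rw [sidePos_contour]
  simp

/-- A planar colored tree with `m + 1` edges given as a noncrossing pairing of the sides met along
the contour. -/
structure ContourTree {D : ℕ} (Q : Finset (Finset (Fin D))) (m : ℕ) where
  flip : Side m → Side m
  flip_flip : ∀ z, flip (flip z) = z
  flip_ne : ∀ z, flip z ≠ z
  noncrossing : ∀ a b, sidePos m a < sidePos m b → sidePos m b < sidePos m (flip a) →
    sidePos m (flip a) < sidePos m (flip b) → False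
  color : Side m → Finset (Fin D)
  color_flip : ∀ z, color (flip z) = color z
  color_mem : ∀ z, color z ∈ Q

namespace ContourTree

variable {D : ℕ} {Q : Finset (Finset (Fin D))} {m : ℕ}

lemma not_crossing (d : ContourTree Q m) (a b : Side m) :
    ¬ ((sidePos m a : ℕ) < sidePos m b ∧ (sidePos m b : ℕ) < sidePos m (d.flip a) ∧
      (sidePos m (d.flip a) : ℕ) < sidePos m (d.flip b)) :=
  fun h => d.noncrossing a b h.1 h.2.1 h.2.2

/-- The orientation-reversed tree. -/
def reflect (d : ContourTree Q m) : ContourTree Q m where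
  flip z := (d.flip z.swap).swap
  flip_flip z := by simp [d.flip_flip]
  flip_ne z h := d.flip_ne z.swap (by rw [← Sum.swap_swap (d.flip z.swap), h])
  noncrossing a b h1 h2 h3 := by
    refine d.noncrossing (d.flip b.swap) (d.flip a.swap) ?_ ?_ ?_ <;>
      simp only [Fin.lt_def, sidePos_swap, d.flip_flip] at * <;> omega
  color z := d.color z.swap
  color_flip z := by simp [d.color_flip]
  color_mem z := d.color_mem _

/-- The pairing obtained by reflecting the first half of the sides onto the second. -/
def mirrorFlip (d : ContourTree Q m) : Side m → Side m
  | Sum.inl k => (d.flip (Sum.inl k)).elim Sum.inl fun _ => Sum.inr k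
  | Sum.inr k => (d.flip (Sum.inl k)).elim Sum.inr fun _ => Sum.inl k

lemma mirrorFlip_mirrorFlip (d : ContourTree Q m) (z : Side m) :
    d.mirrorFlip (d.mirrorFlip z) = z := by
  rcases z with k | k <;> rcases hk : d.flip (Sum.inl k) with l | l <;>
    simp [mirrorFlip, hk] <;> simp [← hk, d.flip_flip]

lemma mirrorFlip_ne (d : ContourTree Q m) (z : Side m) : d.mirrorFlip z ≠ z := by
  rcases z with k | k <;> rcases hk : d.flip (Sum.inl k) with l | l <;>
    simp [mirrorFlip, hk] <;> rintro rfl <;> exact d.flip_ne _ hk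

/-- Edges cut by the axis become nested pairs `inl k`, `inr k`, and edges inside opposite halves are
disjoint. Any other crossing would already be present, possibly after reflection, among the sides of
the first half of `d`. -/
lemma mirrorFlip_noncrossing (d : ContourTree Q m) (a b : Side m)
    (h1 : sidePos m a < sidePos m b) (h2 : sidePos m b < sidePos m (d.mirrorFlip a))
    (h3 : sidePos m (d.mirrorFlip a) < sidePos m (d.mirrorFlip b)) : False := by
  simp only [Fin.lt_def] at h1 h2 h3
  rcases a with a | a <;> rcases b with b | b <;>
    rcases ha : d.flip (Sum.inl a) with a' | a' <;> rcases hb : d.flip (Sum.inl b) with b' | b' <;>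
    have ha' : d.flip (d.flip (Sum.inl a)) = Sum.inl a := d.flip_flip _ <;>
    have hb' : d.flip (d.flip (Sum.inl b)) = Sum.inl b := d.flip_flip _ <;>
    have n1 := d.not_crossing (Sum.inl a) (Sum.inl b) <;>
    have n2 := d.not_crossing (d.flip (Sum.inl b)) (d.flip (Sum.inl a)) <;>
    have n3 := d.not_crossing (d.flip (Sum.inl b)) (Sum.inl a) <;>
    rw [ha] at ha' <;> rw [hb] at hb' <;>
    simp only [mirrorFlip, ha, hb, ha', hb', Sum.elim_inl, Sum.elim_inr, sidePos_inl,
      sidePos_inr] at h1 h2 h3 n1 n2 n3 <;> omega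

/-- The tree obtained by gluing the first half of the contour to its mirror image. -/
def mirror (d : ContourTree Q m) : ContourTree Q m where
  flip := d.mirrorFlip
  flip_flip := d.mirrorFlip_mirrorFlip
  flip_ne := d.mirrorFlip_ne
  noncrossing := d.mirrorFlip_noncrossing
  color := Sum.elim (d.color ∘ Sum.inl) (d.color ∘ Sum.inl)
  color_flip z := by
    rcases z with k | k <;> rcases hk : d.flip (Sum.inl k) with l | l <;>
      simp [mirrorFlip, hk] <;> rw [← hk, d.color_flip]
  color_mem z := by rcases z with k | k <;> exact d.color_mem _

lemma reflect_mirror (d : ContourTree Q m) : d.mirror.reflect = d.mirror := by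
  have h1 : d.mirror.reflect.flip = d.mirror.flip := by
    funext z
    rcases z with k | k <;> rcases hk : d.flip (Sum.inl k) with l | l <;>
      simp [mirror, reflect, mirrorFlip, hk]
  have h2 : d.mirror.reflect.color = d.mirror.color := by
    funext z
    rcases z with k | k <;> rfl
  generalize d.mirror.reflect = x at *
  generalize d.mirror = y at *
  cases x; cases y
  simp_all

/-- The pairing as a permutation. -/
def flipPerm (d : ContourTree Q m) : Equiv.Perm (Side m) :=
  Function.Involutive.toPerm d.flip d.flip_flip

@[simp]
lemma flipPerm_apply (d : ContourTree Q m) (z : Side m) : d.flipPerm z = d.flip z := rfl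

/-- Noncrossing says that no other pair straddles the arc from `a` to `flip a`. -/
lemma arc_flip_iff (d : ContourTree Q m) {a z : Side m} (ha : sidePos m a < sidePos m (d.flip a))
    (h1 : z ≠ a) (h2 : z ≠ d.flip a) :
    (sidePos m a ≤ sidePos m (d.flip z) ∧ sidePos m (d.flip z) < sidePos m (d.flip a)) ↔
      (sidePos m a ≤ sidePos m z ∧ sidePos m z < sidePos m (d.flip a)) := by
  have n1 := d.not_crossing a z
  have n2 := d.not_crossing z a
  have n3 := d.not_crossing a (d.flip z)
  have n4 := d.not_crossing (d.flip z) a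
  have e1 := (sidePos m).injective.ne h1
  have e2 := (sidePos m).injective.ne h2
  have e3 : sidePos m (d.flip z) ≠ sidePos m a :=
    (sidePos m).injective.ne fun h => h2 (by rw [← h, d.flip_flip])
  have e4 : sidePos m (d.flip z) ≠ sidePos m (d.flip a) :=
    (sidePos m).injective.ne fun h => h1 (by rw [← d.flip_flip z, h, d.flip_flip])
  simp only [d.flip_flip, Fin.lt_def, Fin.le_def, ne_eq, Fin.ext_iff] at *
  omega

/-- The arc is half-open, containing `a` but not `flip a`. The contour step into `a` enters the arc
and pairing then leaves it; at `flip a` the reverse happens. The arc is therefore a union of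
vertices. -/
lemma arc_rot_iff (d : ContourTree Q m) {a : Side m} (ha : sidePos m a < sidePos m (d.flip a))
    (k : Side m) :
    (sidePos m a ≤ sidePos m (d.flip (contour m k)) ∧
        sidePos m (d.flip (contour m k)) < sidePos m (d.flip a)) ↔
      (sidePos m a ≤ sidePos m k ∧ sidePos m k < sidePos m (d.flip a)) := by
  have hc := sidePos_contour k
  have hb := (sidePos m (d.flip a)).isLt
  have hk := (sidePos m k).isLt
  by_cases h1 : contour m k = a
  · rw [h1] at hc ⊢
    simp only [Fin.lt_def, Fin.le_def] at *
    split_ifs at hc <;> omega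
  by_cases h2 : contour m k = d.flip a
  · rw [h2] at hc ⊢
    simp only [Fin.lt_def, Fin.le_def, d.flip_flip] at *
    split_ifs at hc <;> omega
  rw [d.arc_flip_iff ha h1 h2]
  have e1 := (sidePos m).injective.ne h1
  have e2 := (sidePos m).injective.ne h2
  simp only [Fin.lt_def, Fin.le_def, ne_eq, Fin.ext_iff] at *
  split_ifs at hc <;> omega

lemma edgesSeparate (d : ContourTree Q m) :
    EdgesSeparate (d.flipPerm * contour m) d.flipPerm := by
  intro a
  rcases lt_or_gt_of_ne ((sidePos m).injective.ne (d.flip_ne a)).symm with h | h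
  · refine ⟨{z | sidePos m a ≤ sidePos m z ∧ sidePos m z < sidePos m (d.flip a)}, ⟨le_rfl, h⟩,
      fun h' => lt_irrefl _ h'.2, fun k => d.arc_rot_iff h k, fun k hk hka => ?_⟩
    exact (d.arc_flip_iff h hka (by rintro rfl; exact lt_irrefl _ hk.2)).2 hk
  · have h0 : sidePos m (d.flip a) < sidePos m (d.flip (d.flip a)) := by rwa [d.flip_flip]
    refine ⟨{z | ¬ (sidePos m (d.flip a) ≤ sidePos m z ∧
        sidePos m z < sidePos m (d.flip (d.flip a)))}, ?_, ?_, fun k => not_congr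
        (d.arc_rot_iff h0 k), fun k hk hka => ?_⟩
    · intro h'; rw [d.flip_flip] at h'; exact lt_irrefl _ h'.2
    · exact not_not.2 ⟨le_rfl, h0⟩
    · refine (not_congr (d.arc_flip_iff h0 ?_ (by rwa [d.flip_flip]))).2 hk
      rintro rfl
      exact hk ⟨le_rfl, h0⟩

end ContourTree

lemma EdgesSeparate.permCongr {H H' : Type*} {rot flip : Equiv.Perm H}
    (hs : EdgesSeparate rot flip) (e : H ≃ H') :
    EdgesSeparate (e.permCongr rot) (e.permCongr flip) := by
  intro a
  obtain ⟨P, h1, h2, h3, h4⟩ := hs (e.symm a)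
  refine ⟨{z | e.symm z ∈ P}, h1, by simpa using h2, fun k => by simpa using h3 (e.symm k),
    fun k hk hka => ?_⟩
  simpa using h4 (e.symm k) hk (e.symm.injective.ne hka)

lemma contour_pow_sidePos {m : ℕ} (i : ℕ) (hi : i < 2 * m + 2) :
    (sidePos m ((contour m ^ i) (Sum.inl 0)) : ℕ) = i := by
  induction i with
  | zero => simp
  | succ i ih =>
    rw [pow_succ', Equiv.Perm.mul_apply, sidePos_contour, ih (by omega), if_neg (by omega)]

lemma contour_sameCycle {m : ℕ} (a b : Side m) : (contour m).SameCycle a b := by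
  have h : ∀ z, (contour m).SameCycle (Sum.inl 0) z := fun z =>
    ⟨(sidePos m z : ℕ), by
      rw [zpow_natCast]
      exact sidePos_ext (contour_pow_sidePos _ (sidePos m z).isLt)⟩
  exact (h a).symm.trans (h b)

lemma sameCycle_permCongr {H H' : Type*} {c : Equiv.Perm H} (e : H ≃ H')
    (hc : ∀ a b, c.SameCycle a b) (a b : H') : (e.permCongr c).SameCycle a b := by
  obtain ⟨i, hi⟩ := hc (e.symm a) (e.symm b)
  refine ⟨i, ?_⟩
  have : e.permCongr c ^ i = e.permCongr (c ^ i) := (map_zpow e.permCongrHom c i).symm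
  rw [this, Equiv.permCongr_apply, hi, Equiv.apply_symm_apply]

/-- The combinatorial map of a tree given by its contour. -/
def ContourTree.toTree {D : ℕ} {Q : Finset (Finset (Fin D))} {m : ℕ} (d : ContourTree Q m) :
    PlanarColoredTree Q (m + 1) :=
  have hff : ∀ h, (sidePos m).permCongr d.flipPerm ((sidePos m).permCongr d.flipPerm h) = h :=
    fun h => by simp [d.flip_flip]
  have hne : ∀ h, (sidePos m).permCongr d.flipPerm h ≠ h := fun h h' =>
    d.flip_ne ((sidePos m).symm h) (by
      rw [Equiv.permCongr_apply, flipPerm_apply] at h'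
      rw [← (sidePos m).symm_apply_apply (d.flip _), h'])
  have hc : ∀ a b, ((sidePos m).permCongr d.flipPerm *
      (sidePos m).permCongr (d.flipPerm * contour m)).SameCycle a b := by
    rw [show (sidePos m).permCongr d.flipPerm * (sidePos m).permCongr (d.flipPerm * contour m) =
      (sidePos m).permCongr (contour m) by ext; simp [d.flip_flip]]
    exact sameCycle_permCongr _ contour_sameCycle
  have hs := d.edgesSeparate.permCongr (sidePos m)
  { rot := (sidePos m).permCongr (d.flipPerm * contour m)
    flip := (sidePos m).permCongr d.flipPerm
    flip_flip := hff
    flip_ne := hne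
    card_vertex := hs.card_vertex hff hne hc
    isTree := hs.isTree hff hc
    color := d.color ∘ (sidePos m).symm
    color_flip := fun h => by simp [d.color_flip]
    color_mem := fun h => d.color_mem _ }

/-! ### Reading a planar tree along its contour -/

namespace PlanarColoredTree

variable {D : ℕ} {Q : Finset (Finset (Fin D))}

/-- The permutation taking a corner to the next one along the contour of the tree. -/
def next {n : ℕ} (T : PlanarColoredTree Q n) : Equiv.Perm T.Corner := T.flip * T.rot

lemma edgesSeparate {n : ℕ} (T : PlanarColoredTree Q n) : EdgesSeparate T.rot T.flip :=
  edgesSeparate_of_isTree T.flip_flip T.flip_ne T.card_vertex T.isTree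

lemma next_sameCycle {n : ℕ} (T : PlanarColoredTree Q n) (a b : T.Corner) :
    T.next.SameCycle a b :=
  T.edgesSeparate.sameCycle T.flip_flip T.isTree.connected a b

lemma next_isCycleOn {n : ℕ} (T : PlanarColoredTree Q n) :
    T.next.IsCycleOn (Finset.univ : Finset T.Corner) :=
  ⟨by simp, fun a _ b _ => T.next_sameCycle a b⟩

variable {m : ℕ} (T : PlanarColoredTree Q (m + 1)) (h : T.Corner)

/-- The corners of a tree enumerated along the contour, starting from `h`. -/
def contourEquiv : Side m ≃ T.Corner :=
  (sidePos m).trans (Equiv.ofBijective (fun i : Fin (2 * (m + 1)) => (T.next ^ (i : ℕ)) h)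
    (Finite.surjective_iff_bijective.1 fun b => by
      obtain ⟨i, hi, rfl⟩ := T.next_isCycleOn.exists_pow_eq (Finset.mem_univ h) (Finset.mem_univ b)
      exact ⟨⟨i, by simpa using hi⟩, rfl⟩))

lemma contourEquiv_apply (z : Side m) :
    T.contourEquiv h z = (T.next ^ (sidePos m z : ℕ)) h := rfl

lemma contourEquiv_contour (z : Side m) :
    T.contourEquiv h (contour m z) = T.next (T.contourEquiv h z) := by
  rw [contourEquiv_apply, contourEquiv_apply, sidePos_contour, ← Equiv.Perm.mul_apply, ← pow_succ']
  split_ifs with hz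
  · have := T.next_isCycleOn.pow_card_apply (Finset.mem_univ h)
    rw [Finset.card_univ, Fintype.card_fin] at this
    rw [hz, show 2 * m + 1 + 1 = 2 * (m + 1) by ring, this, pow_zero, Equiv.Perm.one_apply]
  · rfl

/-- A tree seen along its contour, starting from the corner `h`. -/
def toContour : ContourTree Q m where
  flip z := (T.contourEquiv h).symm (T.flip (T.contourEquiv h z))
  flip_flip z := by simp [T.flip_flip]
  flip_ne z hz := T.flip_ne (T.contourEquiv h z) ((Equiv.symm_apply_eq _).1 hz)
  noncrossing a b h1 h2 h3 := by
    set e := T.contourEquiv h with he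
    obtain ⟨P, p1, p2, p3, p4⟩ := T.edgesSeparate (e a)
    have p5 : ∀ k ∉ P, k ≠ T.flip (e a) → T.flip k ∉ P := by
      intro k hk hka hP
      have := p4 _ hP fun h' => hka (by rw [← h', T.flip_flip])
      rw [T.flip_flip] at this
      exact hk this
    have hrot : ∀ i : Fin (2 * (m + 1)), ∀ hi : (i : ℕ) + 1 < 2 * (m + 1),
        T.rot (e ((sidePos m).symm i)) = T.flip (e ((sidePos m).symm ⟨i + 1, hi⟩)) := by
      intro i hi
      have : (sidePos m).symm ⟨i + 1, hi⟩ = contour m ((sidePos m).symm i) := by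
        apply sidePos_ext
        rw [sidePos_contour]
        simp
        omega
      rw [this, he, contourEquiv_contour, next, Equiv.Perm.mul_apply, T.flip_flip]
    -- The contour is inside `P` from `a` until `flip a` and outside from there to its end. A
    -- crossing pair would have one side in each part, whereas the edge of `a` alone leaves `P`.
    have hin : ∀ j : ℕ, ∀ hj : j < sidePos m (e.symm (T.flip (e a))), sidePos m a ≤ j →
        e ((sidePos m).symm ⟨j, hj.trans (Fin.isLt _)⟩) ∈ P := by
      intro j hj haj
      induction j, haj using Nat.le_induction with
      | base => simpa using p1
      | succ j haj ih =>
        have hP := ih (by omega)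
        rw [← p3, hrot _ (by simpa using hj.trans (Fin.isLt _))] at hP
        by_contra hcon
        refine p5 _ hcon ?_ hP
        intro heq
        rw [← Equiv.eq_symm_apply, Equiv.symm_apply_eq] at heq
        rw [← heq] at hj
        simp at hj
    have hout : ∀ j : ℕ, ∀ hj : j < 2 * (m + 1),
        (sidePos m (e.symm (T.flip (e a))) : ℕ) ≤ j →
        e ((sidePos m).symm ⟨j, hj⟩) ∉ P := by
      intro j hj haj
      induction j, haj using Nat.le_induction with
      | base => simpa using p2
      | succ j haj ih =>
        have hP := ih (by omega)
        rw [← p3, hrot _ hj] at hP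
        intro hcon
        refine hP (p4 _ hcon ?_)
        intro heq
        rw [e.apply_eq_iff_eq, Equiv.symm_apply_eq] at heq
        have := congrArg Fin.val heq
        simp only [Fin.lt_def] at *
        omega
    have hb := hin (sidePos m b) h2 h1.le
    have hfb := hout (sidePos m (e.symm (T.flip (e b)))) (Fin.isLt _) h3.le
    simp only [Fin.eta, Equiv.symm_apply_apply, Equiv.apply_symm_apply] at hb hfb
    exact hfb (p4 _ hb fun heq => h1.ne (by rw [e.injective heq]))
  color z := T.color (T.contourEquiv h z)
  color_flip z := by simp [T.color_flip]
  color_mem z := T.color_mem _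

end PlanarColoredTree

/-! ### Factorization of the amplitude over the two halves of the contour -/

/-- The amplitude of a colored combinatorial map with corners `H`, contour `c` and edges `f`. -/
def contourContract {D N : ℕ} {H : Type*} [Fintype H] [DecidableEq H] (c f : H → H)
    (color : H → Finset (Fin D)) (X : H → Op D N) : ℂ :=
  ∑ i : H → Idx D N, ∑ j : H → Idx D N,
    (∏ h, X h (i h) (j h)) *
      ∏ h, ∏ x, if j h x = i (if x ∈ color (c h) then c h else f (c h)) x then 1 else 0

lemma contourContract_equiv {D N : ℕ} {H H' : Type*} [Fintype H] [DecidableEq H] [Fintype H']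
    [DecidableEq H'] (e : H ≃ H') {c f : H → H} {color : H → Finset (Fin D)} {c' f' : H' → H'}
    {color' : H' → Finset (Fin D)} (hc : ∀ z, c' (e z) = e (c z)) (hf : ∀ z, f' (e z) = e (f z))
    (hcol : ∀ z, color' (e z) = color z) (X : H' → Op D N) :
    contourContract c' f' color' X = contourContract c f color (X ∘ e) := by
  refine (Fintype.sum_equiv (Equiv.arrowCongr e (Equiv.refl _)) _ _ fun i => ?_).symm
  refine Fintype.sum_equiv (Equiv.arrowCongr e (Equiv.refl _)) _ _ fun j => ?_
  congr 1
  · exact Fintype.prod_equiv e _ _ fun h => by simp [Equiv.arrowCongr]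
  · refine Fintype.prod_equiv e _ _ fun h => Finset.prod_congr rfl fun x _ => ?_
    simp only [Equiv.arrowCongr, Equiv.coe_fn_mk, Function.comp_apply, Equiv.refl_apply, hc, hf,
      hcol, Equiv.symm_apply_apply]
    congr 2
    split_ifs <;> simp

lemma PlanarColoredTree.contract_eq {D N n : ℕ} {Q : Finset (Finset (Fin D))}
    (T : PlanarColoredTree Q n) (X : T.Corner → Op D N) :
    T.contract X = contourContract T.next T.flip T.color X := by
  have : ∀ x h, T.strand x h =
      if x ∈ T.color (T.next h) then T.next h else T.flip (T.next h) := fun x h => by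
    simp [PlanarColoredTree.strand, PlanarColoredTree.next, T.color_flip, T.flip_flip]
  simp only [PlanarColoredTree.contract, contourContract, this]

section Half

variable {D N : ℕ} {Q : Finset (Finset (Fin D))} {m : ℕ}

/-- The amplitude of a tree given by its contour. -/
def ContourTree.contract (d : ContourTree Q m) (X : Side m → Op D N) : ℂ :=
  contourContract (contour m) d.flip d.color X

lemma ContourTree.contract_toTree (d : ContourTree Q m) (X : Fin (2 * (m + 1)) → Op D N) :
    d.toTree.contract X = d.contract (X ∘ sidePos m) := by
  rw [PlanarColoredTree.contract_eq]
  refine contourContract_equiv (sidePos m) (fun z => ?_) (fun z => ?_) (fun z => ?_) X <;>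
    simp [PlanarColoredTree.next, toTree, d.flip_flip]

lemma PlanarColoredTree.contract_toContour (T : PlanarColoredTree Q (m + 1)) (h : T.Corner)
    (X : T.Corner → Op D N) : T.contract X = (T.toContour h).contract (X ∘ T.contourEquiv h) := by
  rw [PlanarColoredTree.contract_eq]
  refine contourContract_equiv (T.contourEquiv h) (fun z => ?_) (fun z => ?_) (fun z => ?_) X
  · rw [contourEquiv_contour]
  · simp [toContour]
  · rfl

/-- Values of the incoming and outgoing indices on the sides of half a contour. -/
abbrev HalfIdx (D N m : ℕ) : Type := (Fin (m + 1) → Idx D N) × (Fin (m + 1) → Idx D N)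

namespace ContourTree

/-- The index identifications along the first half of the contour. -/
def HalfCompatible (d : ContourTree Q m) (y : HalfIdx D N m) : Prop :=
  ∀ k x, (x ∈ d.color (Sum.inl k) → y.1 k x = y.2 k x) ∧
    (x ∉ d.color (Sum.inl k) → ∀ l, d.flip (Sum.inl k) = Sum.inl l → y.1 k x = y.2 l x)

open Classical in
/-- The contribution of the first half of the contour, bearing the operators `X` on its corners. -/
def halfWeight (d : ContourTree Q m) (X : Fin m → Op D N) (y : HalfIdx D N m) : ℂ :=
  (∏ k : Fin m, X k (y.2 k.castSucc) (y.1 k.succ)) * if d.HalfCompatible y then 1 else 0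

/-- The indices carried by the edges joining the two halves of the contour. -/
def halfBoundary (d : ContourTree Q m) (y : HalfIdx D N m) (k : Fin (m + 1)) (x : Fin D) :
    Option (Fin N × Fin N) :=
  if x ∈ d.color (Sum.inl k) then none
  else (d.flip (Sum.inl k)).elim (fun _ => none) fun _ => some (y.1 k x, y.2 k x)

/-- The indices carried by the edges joining the two halves of the contour, read off from the
second half and labelled by the sides of the first. -/
def oppositeBoundary (d : ContourTree Q m) (y : HalfIdx D N m) (k : Fin (m + 1)) (x : Fin D) :
    Option (Fin N × Fin N) :=
  (d.flip (Sum.inl k)).elim (fun _ => none) fun l => d.reflect.halfBoundary y l x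

/-- Strands whose color belongs to an edge continue along the contour on the same side, so they are
constrained within one half even at a cut edge. Only the other colors of cut edges link the halves.
The second half is read backwards, which exchanges incoming and outgoing indices. -/
lemma compatible_iff (d : ContourTree Q m) (y y' : HalfIdx D N m) :
    (∀ z x, (Sum.elim y.1 y'.2 : Side m → Idx D N) z x =
      (Sum.elim y.2 y'.1 : Side m → Idx D N) (if x ∈ d.color z then z else d.flip z) x) ↔
    d.HalfCompatible y ∧ d.reflect.HalfCompatible y' ∧
      d.halfBoundary y = d.oppositeBoundary y' := by
  constructor
  · intro h
    refine ⟨fun k x => ⟨fun hx => ?_, fun hx l hl => ?_⟩,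
      fun k x => ⟨fun hx => ?_, fun hx l hl => ?_⟩, ?_⟩
    · simpa [hx] using h (Sum.inl k) x
    · simpa [hx, hl] using h (Sum.inl k) x
    · have hx' : x ∈ d.color (Sum.inr k) := hx
      simpa [hx'] using (h (Sum.inr k) x).symm
    · have hx' : x ∉ d.color (Sum.inr k) := hx
      have hl' : d.flip (Sum.inr k) = Sum.inr l := by
        rw [← Sum.swap_swap (d.flip (Sum.inr k))]
        exact congrArg Sum.swap hl
      have hl2 : d.flip (Sum.inr l) = Sum.inr k := by rw [← hl', d.flip_flip]
      have hc : x ∉ d.color (Sum.inr l) := by rwa [← hl', d.color_flip]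
      simpa [hc, hl2] using (h (Sum.inr l) x).symm
    · funext k x
      rcases hk : d.flip (Sum.inl k) with l | l
      · simp [halfBoundary, oppositeBoundary, hk]
      · have hl : d.flip (Sum.inr l) = Sum.inl k := by rw [← hk, d.flip_flip]
        have hc : d.color (Sum.inr l) = d.color (Sum.inl k) := by rw [← hk, d.color_flip]
        have h1 := h (Sum.inl k) x
        have h2 := h (Sum.inr l) x
        by_cases hx : x ∈ d.color (Sum.inl k)
        · simp [halfBoundary, oppositeBoundary, hk, reflect, hc, hx]
        · simp [hx, hk, hc, hl] at h1 h2
          simp [halfBoundary, oppositeBoundary, hk, reflect, hc, hx, hl, h1, h2]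
  · rintro ⟨h1, h2, h3⟩ z x
    have key : ∀ k l, d.flip (Sum.inl k) = Sum.inr l → x ∉ d.color (Sum.inl k) →
        y.1 k x = y'.1 l x ∧ y.2 k x = y'.2 l x := by
      intro k l hk hx
      have hl : d.flip (Sum.inr l) = Sum.inl k := by rw [← hk, d.flip_flip]
      have hc : d.color (Sum.inr l) = d.color (Sum.inl k) := by rw [← hk, d.color_flip]
      have := congrFun (congrFun h3 k) x
      simpa [halfBoundary, oppositeBoundary, hk, reflect, hc, hx, hl] using this
    by_cases hx : x ∈ d.color z
    · rw [if_pos hx]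
      rcases z with k | k
      · exact (h1 k x).1 hx
      · exact ((h2 k x).1 hx).symm
    · rw [if_neg hx]
      rcases z with k | k
      · rcases hk : d.flip (Sum.inl k) with l | l
        · exact (h1 k x).2 hx l hk
        · exact (key k l hk hx).1
      · rcases hk : d.flip (Sum.inr k) with l | l
        · have hl : d.flip (Sum.inl l) = Sum.inr k := by rw [← hk, d.flip_flip]
          exact (key l k hl (by rwa [← hk, d.color_flip])).2.symm
        · have hl : d.flip (Sum.inr l) = Sum.inr k := by rw [← hk, d.flip_flip]
          refine ((h2 l x).2 ?_ k ?_).symm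
          · change x ∉ d.color (Sum.inr l)
            rwa [← hk, d.color_flip]
          · change (d.flip (Sum.inr l)).swap = _
            rw [hl]; rfl

/-- Index assignments to all corners, as pairs of index assignments to the two halves. -/
def splitEquiv (D N m : ℕ) :
    HalfIdx D N m × HalfIdx D N m ≃ (Side m → Idx D N) × (Side m → Idx D N) where
  toFun y := (Sum.elim y.1.2 y.2.1, fun h => (Sum.elim y.1.1 y.2.2 : Side m → _) (contour m h))
  invFun w := ((fun k => w.2 ((contour m).symm (Sum.inl k)), fun k => w.1 (Sum.inl k)),
    (fun k => w.1 (Sum.inr k), fun k => w.2 ((contour m).symm (Sum.inr k))))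
  left_inv y := by simp
  right_inv w := by
    refine Prod.ext ?_ ?_
    · funext z; rcases z with k | k <;> rfl
    · funext z
      dsimp only
      rw [show w.2 z = w.2 ((contour m).symm (contour m z)) by simp]
      rcases contour m z with k | k <;> rfl

-- Corner `z` lies between the sides `z` and `contour m z`. Thus `m` corners fall inside each half,
-- and `inl (last m)` and `inr 0` lie on the axis. Reading the second half backwards transposes its
-- operators; the outer `star` cancels the conjugation in `conjTranspose`.
open Classical in
lemma contract_eq_sum (d : ContourTree Q m) (X : Side m → Op D N) :
    d.contract X = ∑ y, ∑ y',
      d.halfWeight (fun k => X (Sum.inl k.castSucc)) y *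
        star (d.reflect.halfWeight (fun k => (X (Sum.inr k.succ)).conjTranspose) y') *
        (if d.halfBoundary y = d.oppositeBoundary y' then 1 else 0) *
        X (Sum.inl (Fin.last m)) (y.2 (Fin.last m)) (y'.2 (Fin.last m)) *
        X (Sum.inr 0) (y'.1 0) (y.1 0) := by
  rw [contract, contourContract, ← Fintype.sum_prod_type', ← Fintype.sum_prod_type']
  refine (Fintype.sum_equiv (splitEquiv D N m) _ _ ?_).symm
  rintro ⟨y, y'⟩
  have hdelta : (∏ h, ∏ x, if (splitEquiv D N m (y, y')).2 h x = (splitEquiv D N m (y, y')).1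
      (if x ∈ d.color (contour m h) then contour m h else d.flip (contour m h)) x
      then (1 : ℂ) else 0) =
      if d.HalfCompatible y ∧ d.reflect.HalfCompatible y' ∧
      d.halfBoundary y = d.oppositeBoundary y' then 1 else 0 := by
    rw [← Fintype.prod_equiv (contour m).symm (fun z => ∏ x,
      if (Sum.elim y.1 y'.2 : Side m → Idx D N) z x =
        (Sum.elim y.2 y'.1 : Side m → Idx D N) (if x ∈ d.color z then z else d.flip z) x
      then (1 : ℂ) else 0) _ (fun z => by simp [splitEquiv])]
    simp only [Finset.prod_ite_zero, Finset.prod_const_one, Finset.mem_univ, true_imp_iff]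
    exact if_congr (d.compatible_iff y y') rfl rfl
  rw [hdelta, Fintype.prod_sum_type, Fin.prod_univ_castSucc, Fin.prod_univ_succ]
  simp only [halfWeight, splitEquiv, Equiv.coe_fn_mk, Sum.elim_inl, Sum.elim_inr,
    contour_inl_castSucc, contour_inl_last, contour_inr_succ, contour_inr_zero, star_mul',
    star_prod, Matrix.conjTranspose_apply, star_star]
  by_cases h1 : d.HalfCompatible y <;> by_cases h2 : d.reflect.HalfCompatible y' <;>
    by_cases h3 : d.halfBoundary y = d.oppositeBoundary y' <;> simp [h1, h2, h3]
  ring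

lemma halfCompatible_mirror (d : ContourTree Q m) (y : HalfIdx D N m) :
    d.mirror.HalfCompatible y ↔ d.HalfCompatible y := by
  refine forall₂_congr fun k x => and_congr Iff.rfl (imp_congr Iff.rfl (forall_congr' fun l => ?_))
  rcases hk : d.flip (Sum.inl k) with l' | l' <;> simp [mirror, mirrorFlip, hk]

lemma halfWeight_mirror (d : ContourTree Q m) (X : Fin m → Op D N) :
    d.mirror.halfWeight X = d.halfWeight X := by
  funext y
  classical
  rw [halfWeight, halfWeight]
  exact congrArg _ (if_congr (d.halfCompatible_mirror y) rfl rfl)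

lemma halfBoundary_mirror (d : ContourTree Q m) (y : HalfIdx D N m) :
    d.mirror.halfBoundary y = d.halfBoundary y := by
  funext k x
  rcases hk : d.flip (Sum.inl k) with l' | l' <;>
    simp [halfBoundary, mirror, mirrorFlip, hk]

lemma oppositeBoundary_mirror (d : ContourTree Q m) (y : HalfIdx D N m) :
    d.mirror.oppositeBoundary y = d.halfBoundary y := by
  funext k x
  rw [oppositeBoundary, reflect_mirror, halfBoundary_mirror]
  rcases hk : d.flip (Sum.inl k) with l' | l' <;>
    simp [mirror, mirrorFlip, hk, halfBoundary]

/-- The two boundary data differ by a relabelling of the cut edges, so either can be used when the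
second half is glued to its own mirror image. -/
lemma oppositeBoundary_eq_iff (d : ContourTree Q m) (y y' : HalfIdx D N m) :
    d.oppositeBoundary y = d.oppositeBoundary y' ↔
      d.reflect.halfBoundary y = d.reflect.halfBoundary y' := by
  constructor
  · intro h
    funext l x
    rcases hl : d.flip (Sum.inr l) with k | k
    · have hk : d.flip (Sum.inl k) = Sum.inr l := by rw [← hl, d.flip_flip]
      have := congrFun (congrFun h k) x
      simpa [oppositeBoundary, hk] using this
    · simp [halfBoundary, reflect, hl]
  · intro h
    funext k x
    rw [oppositeBoundary, oppositeBoundary, h]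

/-- The operators on the corners of a mirrored contour: `V` on the first half, their adjoints on the
second, and `1` at the two corners lying on the axis. -/
def mirrorOps (V : Fin m → Op D N) : Side m → Op D N :=
  Sum.elim (Fin.lastCases 1 V) (Fin.cases 1 fun k => (V k).conjTranspose)

end ContourTree

end Half

/-! ### Hilbert–Schmidt norms and contractions -/

section HilbertSchmidt

variable {ι : Type*} [Fintype ι]

/-- The square of the Hilbert-Schmidt norm. -/
def hsSq (M : Matrix ι ι ℂ) : ℝ := ∑ i, ∑ j, ‖M i j‖ ^ 2

lemma hsSq_nonneg (M : Matrix ι ι ℂ) : 0 ≤ hsSq M :=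
  Finset.sum_nonneg fun _ _ => Finset.sum_nonneg fun _ _ => sq_nonneg _

lemma hsSq_conjTranspose (M : Matrix ι ι ℂ) : hsSq M.conjTranspose = hsSq M := by
  simp only [hsSq, Matrix.conjTranspose_apply, norm_star]
  exact Finset.sum_comm

lemma trace_mul_conjTranspose (M : Matrix ι ι ℂ) :
    (M * M.conjTranspose).trace = (hsSq M : ℂ) := by
  simp only [Matrix.trace, Matrix.diag_apply, Matrix.mul_apply, Matrix.conjTranspose_apply, hsSq,
    Complex.ofReal_sum, Complex.ofReal_pow]
  refine Finset.sum_congr rfl fun i _ => Finset.sum_congr rfl fun j _ => ?_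
  exact Complex.mul_conj' _

/-- The contraction `U` acts on each column of `M` separately. -/
lemma hsSq_mul_left_le [DecidableEq ι] (U M : Matrix ι ι ℂ) (hU : ‖U‖ ≤ 1) :
    hsSq (U * M) ≤ hsSq M := by
  have hcol : ∀ A : Matrix ι ι ℂ, hsSq A = ∑ j, ∑ i, ‖A i j‖ ^ 2 := fun A => Finset.sum_comm
  rw [hcol, hcol]
  refine Finset.sum_le_sum fun j _ => ?_
  have h := Matrix.l2_opNorm_mulVec U (WithLp.toLp 2 fun i => M i j)
  have h2 : ‖(WithLp.toLp 2 (U.mulVec fun i => M i j) : EuclideanSpace ℂ ι)‖ ≤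
      ‖(WithLp.toLp 2 (fun i => M i j) : EuclideanSpace ℂ ι)‖ :=
    h.trans (mul_le_of_le_one_left (norm_nonneg _) hU)
  have h3 := pow_le_pow_left₀ (norm_nonneg _) h2 2
  rw [EuclideanSpace.norm_sq_eq, EuclideanSpace.norm_sq_eq] at h3
  exact h3

lemma hsSq_mul_right_le [DecidableEq ι] (M U : Matrix ι ι ℂ) (hU : ‖U‖ ≤ 1) :
    hsSq (M * U) ≤ hsSq M := by
  rw [← hsSq_conjTranspose, Matrix.conjTranspose_mul, ← hsSq_conjTranspose M]
  exact hsSq_mul_left_le _ _ (by rwa [Matrix.l2_opNorm_conjTranspose])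

lemma norm_sum_trace_mul_sq_le {J : Type*} [Fintype J] (P R : J → Matrix ι ι ℂ) :
    ‖∑ I, (P I * R I).trace‖ ^ 2 ≤ (∑ I, hsSq (P I)) * ∑ I, hsSq (R I) := by
  have h1 : ‖∑ I, (P I * R I).trace‖ ≤
      ∑ w : J × ι × ι, ‖P w.1 w.2.1 w.2.2‖ * ‖R w.1 w.2.2 w.2.1‖ := by
    simp only [Fintype.sum_prod_type]
    refine (norm_sum_le _ _).trans (Finset.sum_le_sum fun I _ => ?_)
    rw [Matrix.trace]
    refine (norm_sum_le _ _).trans (Finset.sum_le_sum fun i _ => ?_)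
    rw [Matrix.diag_apply, Matrix.mul_apply]
    refine (norm_sum_le _ _).trans (Finset.sum_le_sum fun j _ => ?_)
    rw [norm_mul]
  refine (pow_le_pow_left₀ (norm_nonneg _) h1 2).trans
    ((Finset.sum_mul_sq_le_sq_mul_sq _ _ _).trans (le_of_eq ?_))
  simp only [Fintype.sum_prod_type, hsSq]
  congr 1
  exact Finset.sum_congr rfl fun I _ => Finset.sum_comm

end HilbertSchmidt

/-! ### Cauchy–Schwarz inequality for two glued halves -/

section CauchySchwarz

variable {ι Y Y' J : Type*} [Fintype ι] [DecidableEq ι] [Fintype Y] [Fintype Y'] [Fintype J]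
  [DecidableEq J]

/-- The pairing of two half contours through the operators `Xb`, `Xa` at the two cut corners. -/
def gluing (f : Y → ℂ) (f' : Y' → ℂ) (b : Y → J) (b' : Y' → J) (u v : Y → ι) (u' v' : Y' → ι)
    (Xb Xa : Matrix ι ι ℂ) : ℂ :=
  ∑ y, ∑ y', f y * star (f' y') * (if b y = b' y' then 1 else 0) * Xb (v y) (v' y') *
    Xa (u' y') (u y)

/-- The operator of a half contour with given indices `I` on the cut edges. -/
def halfOp (f : Y → ℂ) (b : Y → J) (u v : Y → ι) (I : J) : Matrix ι ι ℂ :=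
  ∑ y, (if b y = I then f y else 0) • Matrix.single (u y) (v y) 1

lemma gluing_eq_sum_trace (f : Y → ℂ) (f' : Y' → ℂ) (b : Y → J) (b' : Y' → J) (u v : Y → ι)
    (u' v' : Y' → ι) (Xb Xa : Matrix ι ι ℂ) :
    gluing f f' b b' u v u' v' Xb Xa =
      ∑ I, (halfOp f b u v I * Xb * (halfOp f' b' u' v' I).conjTranspose * Xa).trace := by
  have hsingle : ∀ y y', (Matrix.single (u y) (v y) 1 * Xb * Matrix.single (v' y') (u' y') 1 *
      Xa).trace = Xb (v y) (v' y') * Xa (u' y') (u y) := by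
    intro y y'
    rw [Matrix.single_mul_mul_single, Matrix.trace_single_mul]
    simp
  have hI : ∀ I, (halfOp f b u v I * Xb * (halfOp f' b' u' v' I).conjTranspose * Xa).trace =
      ∑ y, ∑ y', (if b y = I then f y else 0) * (if b' y' = I then star (f' y') else 0) *
        (Xb (v y) (v' y') * Xa (u' y') (u y)) := by
    intro I
    simp only [halfOp, Matrix.conjTranspose_sum, Matrix.conjTranspose_smul,
      Matrix.conjTranspose_single, star_one, Finset.sum_mul, Finset.mul_sum, Matrix.trace_sum,
      Matrix.smul_mul, Matrix.mul_smul, Matrix.trace_smul, hsingle, smul_eq_mul]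
    rw [Finset.sum_comm]
    refine Finset.sum_congr rfl fun y _ => Finset.sum_congr rfl fun y' _ => ?_
    split_ifs <;> simp
    ring
  simp only [hI]
  rw [gluing]
  symm
  rw [Finset.sum_comm]
  refine Finset.sum_congr rfl fun y _ => ?_
  rw [Finset.sum_comm]
  refine Finset.sum_congr rfl fun y' _ => ?_
  by_cases h : b y = b' y'
  · rw [Finset.sum_eq_single (b y)] <;> simp +contextual [h, mul_assoc, eq_comm]
  · refine (Finset.sum_eq_zero fun I _ => ?_).trans ?_
    · by_cases h1 : b y = I
      · simp [← h1, Ne.symm h]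
      · simp [h1]
    · simp [h]

/-- Cauchy-Schwarz inequality for the gluing of two half contours. -/
lemma norm_gluing_sq_le (f : Y → ℂ) (f' : Y' → ℂ) (b : Y → J) (b' : Y' → J) (u v : Y → ι)
    (u' v' : Y' → ι) (S Ub Ua : Matrix ι ι ℂ) (hS : S.conjTranspose = S) (hb : ‖Ub‖ ≤ 1)
    (ha : ‖Ua‖ ≤ 1) :
    ∃ r r' : ℝ, 0 ≤ r ∧ 0 ≤ r' ∧ gluing f f b b u v u v (S * S) (S * S) = r ∧
      gluing f' f' b' b' u' v' u' v' (S * S) (S * S) = r' ∧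
      ‖gluing f f' b b' u v u' v' (S * Ub * S) (S * Ua * S)‖ ^ 2 ≤ r * r' := by
  have hself : ∀ F : Matrix ι ι ℂ, (F * (S * S) * F.conjTranspose * (S * S)).trace =
      (hsSq (S * F * S) : ℂ) := by
    intro F
    rw [← trace_mul_conjTranspose, Matrix.conjTranspose_mul, Matrix.conjTranspose_mul, hS,
      ← mul_assoc, Matrix.trace_mul_comm]
    simp only [mul_assoc]
  refine ⟨∑ I, hsSq (S * halfOp f b u v I * S), ∑ I, hsSq (S * halfOp f' b' u' v' I * S),
    Finset.sum_nonneg fun _ _ => hsSq_nonneg _, Finset.sum_nonneg fun _ _ => hsSq_nonneg _,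
    ?_, ?_, ?_⟩
  · simp only [gluing_eq_sum_trace, hself, Complex.ofReal_sum]
  · simp only [gluing_eq_sum_trace, hself, Complex.ofReal_sum]
  · rw [gluing_eq_sum_trace]
    -- Each cut corner gives one factor `S` to either half, leaving only the contractions `Ub` and
    -- `Ua` between `S F S` and the adjoint of `S F' S`.
    have : ∀ F F' : Matrix ι ι ℂ, (F * (S * Ub * S) * F'.conjTranspose * (S * Ua * S)).trace =
        ((S * F * S) * (Ub * (S * F' * S).conjTranspose * Ua)).trace := by
      intro F F'
      rw [Matrix.conjTranspose_mul, Matrix.conjTranspose_mul, hS, ← mul_assoc,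
        Matrix.trace_mul_comm]
      simp only [mul_assoc]
    simp only [this]
    refine (norm_sum_trace_mul_sq_le _ _).trans (mul_le_mul_of_nonneg_left
      (Finset.sum_le_sum fun I _ => ?_) (Finset.sum_nonneg fun _ _ => hsSq_nonneg _))
    refine (hsSq_mul_right_le _ _ ha).trans ((hsSq_mul_left_le _ _ hb).trans ?_)
    rw [hsSq_conjTranspose]

end CauchySchwarz

/-! ### Cauchy–Schwarz inequality for trees -/

namespace ContourTree

variable {D N : ℕ} {Q : Finset (Finset (Fin D))} {m : ℕ}

open Classical in
lemma contract_eq_gluing (d : ContourTree Q m) (X : Side m → Op D N) :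
    d.contract X = gluing (d.halfWeight fun k => X (Sum.inl k.castSucc))
      (d.reflect.halfWeight fun k => (X (Sum.inr k.succ)).conjTranspose)
      d.halfBoundary d.oppositeBoundary (fun y => y.1 0) (fun y => y.2 (Fin.last m))
      (fun y => y.1 0) (fun y => y.2 (Fin.last m)) (X (Sum.inl (Fin.last m))) (X (Sum.inr 0)) :=
  d.contract_eq_sum X

open Classical in
lemma contract_mirror (d : ContourTree Q m) (S : Op D N) (hS : S.conjTranspose = S)
    (V : Fin m → Op D N) :
    d.mirror.contract (fun z => S * mirrorOps V z * S) =
      gluing (d.halfWeight fun k => S * V k * S) (d.halfWeight fun k => S * V k * S)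
        d.halfBoundary d.halfBoundary (fun y => y.1 0) (fun y => y.2 (Fin.last m))
        (fun y => y.1 0) (fun y => y.2 (Fin.last m)) (S * S) (S * S) := by
  rw [contract_eq_gluing, reflect_mirror, halfWeight_mirror, halfWeight_mirror,
    funext d.halfBoundary_mirror, funext d.oppositeBoundary_mirror]
  simp [mirrorOps, Matrix.conjTranspose_mul, hS, mul_assoc]

/-- Cutting a tree at two opposite corners bounds its amplitude by those of the two trees obtained
by doubling either half. -/
lemma norm_contract_sq_le (d : ContourTree Q m) (S : Op D N) (hS : S.conjTranspose = S)
    (U : Side m → Op D N) (hU : ∀ z, ‖U z‖ ≤ 1) :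
    ∃ r r' : ℝ, 0 ≤ r ∧ 0 ≤ r' ∧
      d.mirror.contract (fun z => S * mirrorOps (fun k => U (Sum.inl k.castSucc)) z * S) = r ∧
      d.reflect.mirror.contract
        (fun z => S * mirrorOps (fun k => (U (Sum.inr k.succ)).conjTranspose) z * S) = r' ∧
      ‖d.contract fun z => S * U z * S‖ ^ 2 ≤ r * r' := by
  classical
  rw [contract_mirror _ _ hS, contract_mirror _ _ hS, contract_eq_gluing]
  obtain ⟨r, r', h1, h2, h3, h4, h5⟩ := norm_gluing_sq_le
    (d.halfWeight fun k => S * U (Sum.inl k.castSucc) * S)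
    (d.reflect.halfWeight fun k => S * (U (Sum.inr k.succ)).conjTranspose * S)
    d.halfBoundary d.oppositeBoundary (fun y => y.1 0) (fun y => y.2 (Fin.last m))
    (fun y => y.1 0) (fun y => y.2 (Fin.last m)) S (U (Sum.inl (Fin.last m))) (U (Sum.inr 0)) hS
    (hU _) (hU _)
  refine ⟨r, r', h1, h2, h3, ?_, ?_⟩
  · rw [← h4]
    -- A self-gluing depends on its boundary data only through equality of their values.
    simp only [gluing, oppositeBoundary_eq_iff]
  · simpa only [Matrix.conjTranspose_mul, hS, mul_assoc] using h5

end ContourTree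

namespace PlanarColoredTree

variable {D N : ℕ} {Q : Finset (Finset (Fin D))}

instance instFinite (n : ℕ) : Finite (PlanarColoredTree Q n) :=
  Finite.of_injective (fun T : PlanarColoredTree Q n => (T.rot, T.flip, T.color)) fun T T' h => by
    cases T; cases T'; simp_all

lemma contract_smul {n : ℕ} (T : PlanarColoredTree Q n) (a : ℂ) (X : T.Corner → Op D N) :
    T.contract (fun h => a • X h) = a ^ (2 * n) * T.contract X := by
  simp only [contract, Finset.mul_sum]
  refine Finset.sum_congr rfl fun i _ => Finset.sum_congr rfl fun j _ => ?_
  simp only [Matrix.smul_apply, smul_eq_mul, Finset.prod_mul_distrib, Finset.prod_const,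
    Finset.card_univ, Fintype.card_fin, mul_assoc]

lemma order_ne_zero {n : ℕ} (T : PlanarColoredTree Q n) : n ≠ 0 := by
  rintro rfl
  have h := T.card_vertex
  have : IsEmpty (MapVertex T.rot) := ⟨fun v => (vertexOf_surjective v).elim fun a _ => a.elim0⟩
  simp at h

lemma next_toTree {m : ℕ} (d : ContourTree Q m) (i : ℕ) (z : Side m) :
    (d.toTree.next ^ i) (sidePos m z) = sidePos m ((contour m ^ i) z) := by
  induction i with
  | zero => rfl
  | succ i ih =>
    rw [pow_succ', pow_succ', Equiv.Perm.mul_apply, ih, Equiv.Perm.mul_apply]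
    simp [next, ContourTree.toTree, d.flip_flip]

end PlanarColoredTree

lemma contour_pow_inl_zero {m : ℕ} (k : Fin (m + 1)) :
    (contour m ^ (k : ℕ)) (Sum.inl 0) = Sum.inl k :=
  sidePos_ext (by rw [contour_pow_sidePos _ (by omega), sidePos_inl])

/-! ### Maximal amplitudes and propagation of the identity -/

section Iteration

variable {D N : ℕ} {Q : Finset (Finset (Fin D))} {m : ℕ} {F : Set (Op D N)}

lemma mirrorOps_mem (h1 : (1 : Op D N) ∈ F) (hF : ∀ U ∈ F, U.conjTranspose ∈ F)
    {V : Fin m → Op D N} (hV : ∀ k, V k ∈ F) (z : Side m) : ContourTree.mirrorOps V z ∈ F := by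
  rcases z with k | k
  · refine Fin.lastCases ?_ (fun k => ?_) k <;> simp [ContourTree.mirrorOps, h1, hV]
  · refine Fin.cases ?_ (fun k => ?_) k <;> simp [ContourTree.mirrorOps, h1, hF _ (hV _)]

/-- The amplitude `(T, U)` is the largest one with corner operators in `F`. -/
def IsMaximal (S : Op D N) (F : Set (Op D N)) (T : PlanarColoredTree Q (m + 1))
    (U : T.Corner → Op D N) : Prop :=
  (∀ h, U h ∈ F) ∧ ∀ (T' : PlanarColoredTree Q (m + 1)) (U' : T'.Corner → Op D N),
    (∀ h, U' h ∈ F) → ‖T'.contract fun h => S * U' h * S‖ ≤ ‖T.contract fun h => S * U h * S‖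

lemma exists_isMaximal (S : Op D N) (hfin : F.Finite) (h1 : (1 : Op D N) ∈ F)
    (T : PlanarColoredTree Q (m + 1)) :
    ∃ (T' : PlanarColoredTree Q (m + 1)) (U : T'.Corner → Op D N), IsMaximal S F T' U := by
  have : Finite F := hfin
  have : Nonempty (PlanarColoredTree Q (m + 1) × (Fin (2 * (m + 1)) → F)) :=
    ⟨(T, fun _ => ⟨1, h1⟩)⟩
  obtain ⟨⟨T', U⟩, hmax⟩ := Finite.exists_max
    fun w : PlanarColoredTree Q (m + 1) × (Fin (2 * (m + 1)) → F) =>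
      ‖w.1.contract fun h => S * (w.2 h : Op D N) * S‖
  exact ⟨T', fun h => U h, fun h => (U h).2, fun T'' U'' hU =>
    hmax (T'', fun h => ⟨U'' h, hU h⟩)⟩

/-- The other mirrored tree also bears operators of `F`, so its amplitude cannot exceed the maximum;
Cauchy–Schwarz then forces the chosen one to reach it. Being real and nonnegative, that amplitude
equals its real part. -/
lemma IsMaximal.mirror {S : Op D N} (hS : S.conjTranspose = S) (h1 : (1 : Op D N) ∈ F)
    (hF : ∀ U ∈ F, U.conjTranspose ∈ F) (hnorm : ∀ U ∈ F, ‖U‖ ≤ 1)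
    {T : PlanarColoredTree Q (m + 1)} {U : T.Corner → Op D N} (hmax : IsMaximal S F T U)
    (h : T.Corner) {U' : (T.toContour h).mirror.toTree.Corner → Op D N}
    (hU' : ∀ z, U' (sidePos m z) =
      ContourTree.mirrorOps (fun k => U (T.contourEquiv h (Sum.inl k.castSucc))) z) :
    IsMaximal S F (T.toContour h).mirror.toTree U' ∧
      ‖T.contract fun h => S * U h * S‖ ≤
        ((T.toContour h).mirror.toTree.contract fun h => S * U' h * S).re := by
  have hmem : ∀ z, U' z ∈ F := fun z => by
    rw [← (sidePos m).apply_symm_apply z, hU']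
    exact mirrorOps_mem h1 hF (fun _ => hmax.1 _) _
  obtain ⟨r, r', hr, hr', e, e', hle⟩ := (T.toContour h).norm_contract_sq_le S hS
    (fun z => U (T.contourEquiv h z)) fun z => hnorm _ (hmax.1 _)
  have hT := T.contract_toContour h fun h => S * U h * S
  have hc : ((T.toContour h).mirror.toTree.contract fun h => S * U' h * S) = r := by
    rw [ContourTree.contract_toTree, ← e]
    simp only [Function.comp_def, hU']
  have hb : r' ≤ ‖T.contract fun h => S * U h * S‖ := by
    have := hmax.2 (T.toContour h).reflect.mirror.toTree
      (fun z => ContourTree.mirrorOps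
        (fun k => (U (T.contourEquiv h (Sum.inr k.succ))).conjTranspose) ((sidePos m).symm z))
      fun z => mirrorOps_mem h1 hF (fun _ => hF _ (hmax.1 _)) _
    rw [ContourTree.contract_toTree] at this
    simp only [Function.comp_def, Equiv.symm_apply_apply] at this
    rwa [e', Complex.norm_real, Real.norm_of_nonneg hr'] at this
  -- With `x` the maximal value, `x² ≤ r r' ≤ r x`; the case `x = 0` is separate because `x` is
  -- cancelled.
  have hle' : ‖T.contract fun h => S * U h * S‖ ≤ r := by
    rw [hT] at hb ⊢
    simp only [Function.comp_def] at hb ⊢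
    generalize ‖(T.toContour h).contract fun z => S * U (T.contourEquiv h z) * S‖ = x at *
    rcases (hr'.trans hb).eq_or_lt with h0 | h0
    · rw [← h0]; exact hr
    · nlinarith
  refine ⟨⟨hmem, fun T' V hV => ?_⟩, by rw [hc, Complex.ofReal_re]; exact hle'⟩
  rw [hc, Complex.norm_real, Real.norm_of_nonneg hr]
  exact (hmax.2 T' V hV).trans hle'

/-- Among the maximal amplitudes there are some with the identity on any number of consecutive
corners. -/
lemma exists_isMaximal_run {S : Op D N} (hS : S.conjTranspose = S) (hfin : F.Finite)
    (h1 : (1 : Op D N) ∈ F) (hF : ∀ U ∈ F, U.conjTranspose ∈ F) (hnorm : ∀ U ∈ F, ‖U‖ ≤ 1)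
    (T₀ : PlanarColoredTree Q (m + 1)) (r : ℕ) (hr : r ≤ m) :
    ∃ (T : PlanarColoredTree Q (m + 1)) (U : T.Corner → Op D N) (h : T.Corner),
      IsMaximal S F T U ∧ ∀ k < r, U ((T.next ^ k) h) = 1 := by
  induction r with
  | zero =>
    obtain ⟨T, U, hmax⟩ := exists_isMaximal S hfin h1 T₀
    exact ⟨T, U, sidePos m (Sum.inl 0), hmax, fun k hk => absurd hk (Nat.not_lt_zero k)⟩
  | succ r ih =>
    obtain ⟨T, U, h, hmax, hrun⟩ := ih (by omega)
    -- The contour starts at the run, so the run is copied to `inl 0, inl 1, …`. The axis corner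
    -- `inr 0` immediately precedes it and bears `1`: this is the gain of one.
    refine ⟨(T.toContour h).mirror.toTree, fun z => ContourTree.mirrorOps
      (fun k => U (T.contourEquiv h (Sum.inl k.castSucc))) ((sidePos m).symm z),
      sidePos m (Sum.inr 0), (hmax.mirror hS h1 hF hnorm h fun z => by simp).1, fun k hk => ?_⟩
    rw [PlanarColoredTree.next_toTree]
    dsimp only
    rw [Equiv.symm_apply_apply]
    rcases k with _ | k
    · simp [ContourTree.mirrorOps]
    -- The run fits in the `m` corners copied from the first half, before the axis corner `inl (last
    -- m)`.
    · have hkm : k < m := by omega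
      rw [pow_succ, Equiv.Perm.mul_apply, contour_inr_zero,
        show k = ((Fin.castSucc ⟨k, hkm⟩ : Fin (m + 1)) : ℕ) from rfl, contour_pow_inl_zero]
      simp only [ContourTree.mirrorOps, Sum.elim_inl, Fin.lastCases_castSucc,
        PlanarColoredTree.contourEquiv_apply, sidePos_inl, Fin.val_castSucc]
      exact hrun k (by omega)

/-- Iterated Cauchy-Schwarz bound for corner operators of norm at most one. -/
lemma exists_norm_contract_le {S : Op D N} (hS : S.conjTranspose = S) (hfin : F.Finite)
    (h1 : (1 : Op D N) ∈ F) (hF : ∀ U ∈ F, U.conjTranspose ∈ F) (hnorm : ∀ U ∈ F, ‖U‖ ≤ 1)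
    (T : PlanarColoredTree Q (m + 1)) (U : T.Corner → Op D N) (hU : ∀ h, U h ∈ F) :
    ∃ T' : PlanarColoredTree Q (m + 1),
      ‖T.contract fun h => S * U h * S‖ ≤ (T'.bareAmplitude (S * S)).re := by
  obtain ⟨T₁, U₁, h, hmax, hrun⟩ := exists_isMaximal_run hS hfin h1 hF hnorm T m le_rfl
  have hone : (fun k : Fin m => U₁ (T₁.contourEquiv h (Sum.inl k.castSucc))) = fun _ => 1 := by
    funext k
    rw [PlanarColoredTree.contourEquiv_apply, sidePos_inl]
    exact hrun k k.isLt
  refine ⟨(T₁.toContour h).mirror.toTree, (hmax.2 T U hU).trans ?_⟩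
  -- A run of length `m` fills the first half, so this last reflection bears `1` at every corner.
  -- `mirrorOps_mem` with the singleton `{1}` expresses this.
  have := (hmax.mirror hS h1 hF hnorm h (U' := fun _ => 1) fun z => by
    have := mirrorOps_mem (F := ({1} : Set (Op D N))) (m := m) (Set.mem_singleton _)
      (by simp) (V := fun _ => 1) (fun _ => rfl) z
    rw [hone]; exact (Set.mem_singleton_iff.1 this).symm).2
  simpa only [mul_one, PlanarColoredTree.bareAmplitude] using this

end Iteration

/-! ### From contractions to resolvents -/

/-- The vanishing intermediate field. -/
def zeroField {D : ℕ} (Q : Finset (Finset (Fin D))) (N : ℕ) : IntermediateField Q N where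
  mat _ := 0
  isHermitian _ := Matrix.isHermitian_zero

lemma resolvent_zeroField {D N : ℕ} {Q : Finset (Finset (Fin D))} (C : Op D N) (lam : ℂ) :
    resolvent C lam (zeroField Q N) = 1 := by
  have : (zeroField Q N).total = 0 :=
    Finset.sum_eq_zero fun c _ => by ext i j; simp [ampliation, zeroField]
  simp [resolvent, this]

end QuarticTensor

end

theorem theorem3p3 {D N : ℕ} (Q : Finset (Finset (Fin D)))
    (C : QuarticTensor.Op D N) (hC : C.PosSemidef)
    (Ω : Set ℂ) (K : ℝ)
    (hK : ∀ lam ∈ Ω, ∀ σ : QuarticTensor.IntermediateField Q N,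
      ‖QuarticTensor.resolvent C lam σ‖ ≤ K)
    (n : ℕ) (T : QuarticTensor.PlanarColoredTree Q n)
    (A A' : Finset T.Corner) (hA : Disjoint A A')
    (lam : ℂ) (hlam : lam ∈ Ω) (σ : T.Corner → QuarticTensor.IntermediateField Q N) :
    ‖T.amplitude C lam σ A A'‖ ≤
      K ^ (2 * n) * ⨆ T' : QuarticTensor.PlanarColoredTree Q n, (T'.bareAmplitude C).re := by
  open QuarticTensor in
  obtain ⟨m, rfl⟩ := Nat.exists_eq_succ_of_ne_zero T.order_ne_zero
  rcases isEmpty_or_nonempty (Idx D N) with hI | hI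
  -- On the zero space the identity has norm `0`, so `1 ≤ K` is unavailable; but all amplitudes
  -- vanish.
  · have h0 : ∀ (T' : PlanarColoredTree Q (m + 1)) (X : T'.Corner → Op D N),
        T'.contract X = 0 := fun T' X =>
      Finset.sum_eq_zero fun i _ => (hI.false (i ⟨0, by omega⟩)).elim
    simp [PlanarColoredTree.amplitude, PlanarColoredTree.bareAmplitude, h0]
  have hK1 : 1 ≤ K := by
    have := hK lam hlam (zeroField Q N)
    rwa [resolvent_zeroField, CStarRing.norm_one] at this
  have hK0 : (0 : ℝ) < K := by linarith
  set S := CFC.sqrt C with hSdef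
  have hS : S.conjTranspose = S := (CFC.sqrt_nonneg C).isSelfAdjoint
  have hSS : S * S = C := CFC.sqrt_mul_sqrt_self C hC.nonneg
  set R : T.Corner → Op D N := fun h =>
    if h ∈ A then resolvent C lam (σ h) else
      if h ∈ A' then (resolvent C lam (σ h)).conjTranspose else 1 with hR
  have hRK : ∀ h, ‖R h‖ ≤ K := by
    intro h
    simp only [hR]
    split_ifs
    · exact hK lam hlam _
    · rw [Matrix.l2_opNorm_conjTranspose]; exact hK lam hlam _
    · rwa [CStarRing.norm_one]
  set U : T.Corner → Op D N := fun h => ((K⁻¹ : ℝ) : ℂ) • R h with hU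
  have hU1 : ∀ h, ‖U h‖ ≤ 1 := by
    intro h
    rw [hU, norm_smul, Complex.norm_real, Real.norm_of_nonneg (by positivity),
      inv_mul_le_iff₀ hK0, mul_one]
    exact hRK h
  have hamp : T.amplitude C lam σ A A' =
      (K : ℂ) ^ (2 * (m + 1)) * T.contract fun h => S * U h * S := by
    rw [← PlanarColoredTree.contract_smul, PlanarColoredTree.amplitude]
    congr 1
    funext h
    have hKc : (K : ℂ) ≠ 0 := by exact_mod_cast hK0.ne'
    simp only [hU, Matrix.mul_smul, Matrix.smul_mul, smul_smul, Complex.ofReal_inv,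
      mul_inv_cancel₀ hKc, one_smul, hR]
    split_ifs
    · rfl
    · rfl
    · rw [mul_one, hSS]
  -- Mirroring introduces only adjoints and, on the axis, `1`, so this finite set is stable under
  -- it.
  obtain ⟨T', hT'⟩ := exists_norm_contract_le (F := {1} ∪ (Set.range U ∪
      Set.range fun h => (U h).conjTranspose)) hS
    ((Set.finite_singleton _).union ((Set.finite_range _).union (Set.finite_range _)))
    (by simp)
    (by rintro _ (rfl | ⟨h, rfl⟩ | ⟨h, rfl⟩) <;> simp)
    (by
      rintro _ (rfl | ⟨h, rfl⟩ | ⟨h, rfl⟩)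
      · rw [CStarRing.norm_one]
      · exact hU1 h
      · simp only [Matrix.l2_opNorm_conjTranspose]; exact hU1 h)
    T U (fun h => Or.inr (Or.inl ⟨h, rfl⟩))
  rw [hamp, norm_mul, norm_pow, Complex.norm_real, Real.norm_of_nonneg hK0.le]
  refine mul_le_mul_of_nonneg_left (hT'.trans ?_) (by positivity)
  rw [hSS]
  exact le_ciSup (f := fun T' : PlanarColoredTree Q (m + 1) => (T'.bareAmplitude C).re)
    (Set.finite_range _).bddAbove T'
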